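/- Let $\mathcal{A}$ be an abelian category and $N\in\mathbb{N}$. An $N$-complex in $\mathcal{A}$ is a diagram $\cdots\to X^{n-1}\xrightarrow{d}X^n\xrightarrow{d}X^{n+1}\to\cdots$ ($n\in\mathbb{Z}$) in $\mathcal{A}$ with $d^N=0$; together with the families of morphisms commuting with $d$, the $N$-complexes form a category $\mathrm{C}_N(\mathcal{A})$. Let $\mathcal{S}_\oplus$ be the Frobenius exact structure on $\mathrm{C}_N(\mathcal{A})$ given by the levelwise split short exact sequences. The homotopy category $\mathrm{K}_N(\mathcal{A})$ is its stable category: it has the same objects as $\mathrm{C}_N(\mathcal{A})$, and its morphisms are the morphisms of $N$-complexes modulo those which factor through an $\mathcal{S}_\oplus$-projective-injective object; it is triangulated, the distinguished triangles being those isomorphic to triangles induced by sequences in $\mathcal{S}_\oplus$. For $1\le r\le N-1$ and $i\in\mathbb{Z}$ put $H^i_{(r)}(X)=\ker(d^r\colon X^i\to X^{i+r})/\operatorname{im}(d^{N-r}\colon X^{i-N+r}\to X^i)$; call $X$ acyclic if $H^i_{(r)}(X)=0$ for all $i\in\mathbb{Z}$ and $1\le r\le N-1$, and let $\mathrm{K}_N(\mathcal{A})^\emptyset\subseteq\mathrm{K}_N(\mathcal{A})$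 be the full subcategory of acyclic objects. Let $\pi\colon\mathrm{K}_N(\mathcal{A})\to\mathrm{D}_N(\mathcal{A})=\mathrm{K}_N(\mathcal{A})/\mathrm{K}_N(\mathcal{A})^\emptyset$ be the Verdier quotient, i.e. the localization of $\mathrm{K}_N(\mathcal{A})$ at the morphisms whose cone is acyclic. Call $X\in\mathrm{K}_N(\mathcal{A})$ h-projective if $\mathrm{K}_N(\mathcal{A})(X,T)=0$ for every acyclic $T$, and let $\text{h-proj}_N(\mathcal{A})\subseteq\mathrm{K}_N(\mathcal{A})$ be the full subcategory of h-projective objects. Theorem. For every h-projective $X$ and every $Y\in\mathrm{K}_N(\mathcal{A})$ the functor $\pi$ induces a bijection $$\mathrm{K}_N(\mathcal{A})(X,Y)\xrightarrow{\ \pi\ }\mathrm{D}_N(\mathcal{A})(X,Y).$$ In particular, the restriction of $\pi$ to $\text{h-proj}_N(\mathcal{A})$ is fully faithful. -/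

import Mathlib

open CategoryTheory CategoryTheory.Limits

universe v u

noncomputable section

/-- An `∞`-complex in `A` is a diagram of shape `⋯ ⟶ X^{n-1} ⟶ X^n ⟶ X^{n+1} ⟶ ⋯`, that is, a functor
`ℤ ⥤ A`. The iterated differential `d^r : X^i ⟶ X^{i+r}` is the image of `i ≤ i + r`.
The `∞`-complex `X` is an `N`-complex if `d^N = 0`. -/
def isNComplex (A : Type u) [Category.{v} A] [Preadditive A] (N : ℕ) : ObjectProperty (ℤ ⥤ A) :=
  fun X => ∀ (i j : ℤ) (h : i + N = j), X.map (homOfLE (show i ≤ j by omega)) = 0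

/-- The category `C_N(A)` of `N`-complexes, a full subcategory of the `∞`-complexes. -/
abbrev NComplex (A : Type u) [Category.{v} A] [Preadditive A] (N : ℕ) :=
  (isNComplex A N).FullSubcategory

namespace NComplex

variable (A : Type u) [Category.{v} A] [Abelian A] (N : ℕ)

/-- The functor `X ↦ X^i`. -/
abbrev level (i : ℤ) : NComplex A N ⥤ A :=
  (isNComplex A N).ι ⋙ (evaluation ℤ A).obj i

variable {A N}

/-- The class `S_⊕`: the sequences `X ⟶ Y ⟶ Z` of `N`-complexes which are split short exact in each
degree. -/
def LevelwiseSplit (S : ShortComplex (NComplex A N)) : Prop :=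
  ∀ i : ℤ, Nonempty (S.map (level A N i)).Splitting

/-- `P` is `S_⊕`-projective. -/
def IsRelProjective (P : NComplex A N) : Prop :=
  ∀ (S : ShortComplex (NComplex A N)), LevelwiseSplit S →
    ∀ f : P ⟶ S.X₃, ∃ g : P ⟶ S.X₂, g ≫ S.g = f

/-- `I` is `S_⊕`-injective. -/
def IsRelInjective (I : NComplex A N) : Prop :=
  ∀ (S : ShortComplex (NComplex A N)), LevelwiseSplit S →
    ∀ f : S.X₁ ⟶ I, ∃ g : S.X₂ ⟶ I, S.f ≫ g = f

/-- `f` factors through an object which is both `S_⊕`-projective and `S_⊕`-injective. -/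
def FactorsThroughProjInj {X Y : NComplex A N} (f : X ⟶ Y) : Prop :=
  ∃ (P : NComplex A N) (a : X ⟶ P) (b : P ⟶ Y),
    IsRelProjective P ∧ IsRelInjective P ∧ f = a ≫ b

variable (A N) in
/-- Two morphisms are identified in the stable category if their difference factors through an
`S_⊕`-projective-injective object. -/
def stableRel : HomRel (NComplex A N) :=
  fun _ _ f g => FactorsThroughProjInj (f - g)

variable (A N) in
/-- The homotopy category `K_N(A)`: the stable category of `C_N(A)` with respect to `S_⊕`. -/
abbrev HomotopyCat := Quotient (stableRel A N)

variable (A N) in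
/-- The projection `C_N(A) ⥤ K_N(A)`. -/
abbrev toHomotopyCat : NComplex A N ⥤ HomotopyCat A N := Quotient.functor (stableRel A N)

/-! Morphisms factoring through an `S_⊕`-projective-injective object form a two-sided ideal, so the
morphisms of `K_N(A)` are the classes modulo this ideal and `K_N(A)` is preadditive. -/

lemma isNComplex_biprod (P Q : NComplex A N) : isNComplex A N (P.obj ⊞ Q.obj) := by
  intro i j h
  have h₁ := P.property i j h
  have h₂ := Q.property i j h
  have e : (P.obj ⊞ Q.obj).map (homOfLE (show i ≤ j by omega)) =
      (P.obj ⊞ Q.obj).map (homOfLE (show i ≤ j by omega)) ≫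
        (biprod.fst ≫ biprod.inl + biprod.snd ≫ biprod.inr : P.obj ⊞ Q.obj ⟶ _).app j := by
    rw [biprod.total]; simp
  rw [e, NatTrans.app_add, Preadditive.comp_add, NatTrans.comp_app, NatTrans.comp_app,
    NatTrans.naturality_assoc, NatTrans.naturality_assoc, h₁, h₂]
  simp

open scoped ZeroObject in
lemma factorsThroughProjInj_zero (X Y : NComplex A N) :
    FactorsThroughProjInj (0 : X ⟶ Y) := by
  refine ⟨⟨0, fun i j h => (isZero_zero (ℤ ⥤ A)).obj i |>.eq_of_src _ _⟩, 0, 0, ?_, ?_, by simp⟩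
  · intro S _ f
    exact ⟨0, by ext1; exact (isZero_zero (ℤ ⥤ A)).eq_of_src _ _⟩
  · intro S _ f
    exact ⟨0, by ext1; exact (isZero_zero (ℤ ⥤ A)).eq_of_tgt _ _⟩

lemma FactorsThroughProjInj.add {X Y : NComplex A N} {f g : X ⟶ Y}
    (hf : FactorsThroughProjInj f) (hg : FactorsThroughProjInj g) :
    FactorsThroughProjInj (f + g) := by
  obtain ⟨P, a, b, hP, hP', rfl⟩ := hf
  obtain ⟨Q, c, d, hQ, hQ', rfl⟩ := hg
  let R : NComplex A N := ⟨P.obj ⊞ Q.obj, isNComplex_biprod P Q⟩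
  let i₁ : P ⟶ R := ObjectProperty.homMk biprod.inl
  let i₂ : Q ⟶ R := ObjectProperty.homMk biprod.inr
  let p₁ : R ⟶ P := ObjectProperty.homMk biprod.fst
  let p₂ : R ⟶ Q := ObjectProperty.homMk biprod.snd
  have h₁₁ : i₁ ≫ p₁ = 𝟙 _ := by ext1; exact biprod.inl_fst
  have h₁₂ : i₁ ≫ p₂ = 0 := by ext1; exact biprod.inl_snd
  have h₂₁ : i₂ ≫ p₁ = 0 := by ext1; exact biprod.inr_fst
  have h₂₂ : i₂ ≫ p₂ = 𝟙 _ := by ext1; exact biprod.inr_snd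
  have ht : p₁ ≫ i₁ + p₂ ≫ i₂ = 𝟙 R := by ext1; exact biprod.total
  refine ⟨R, a ≫ i₁ + c ≫ i₂, p₁ ≫ b + p₂ ≫ d, ?_, ?_, ?_⟩
  · intro S hS f
    obtain ⟨g₁, h₁⟩ := hP S hS (i₁ ≫ f)
    obtain ⟨g₂, h₂⟩ := hQ S hS (i₂ ≫ f)
    refine ⟨p₁ ≫ g₁ + p₂ ≫ g₂, ?_⟩
    rw [Preadditive.add_comp, Category.assoc, Category.assoc, h₁, h₂, ← Category.assoc,
      ← Category.assoc, ← Preadditive.add_comp, ht, Category.id_comp]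
  · intro S hS f
    obtain ⟨g₁, h₁⟩ := hP' S hS (f ≫ p₁)
    obtain ⟨g₂, h₂⟩ := hQ' S hS (f ≫ p₂)
    refine ⟨g₁ ≫ i₁ + g₂ ≫ i₂, ?_⟩
    rw [Preadditive.comp_add, ← Category.assoc, ← Category.assoc, h₁, h₂, Category.assoc,
      Category.assoc, ← Preadditive.comp_add, ht, Category.comp_id]
  · simp [reassoc_of% h₁₁, reassoc_of% h₁₂, reassoc_of% h₂₁, reassoc_of% h₂₂]

lemma FactorsThroughProjInj.neg {X Y : NComplex A N} {f : X ⟶ Y}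
    (hf : FactorsThroughProjInj f) : FactorsThroughProjInj (-f) := by
  obtain ⟨P, a, b, hP, hP', rfl⟩ := hf
  exact ⟨P, a, -b, hP, hP', by simp⟩

instance : Congruence (stableRel A N) where
  equivalence :=
    { refl := fun f => by
        simpa only [stableRel, sub_self] using factorsThroughProjInj_zero _ _
      symm := fun {f g} h => by
        have := FactorsThroughProjInj.neg h
        rwa [neg_sub] at this
      trans := fun {f g h} h₁ h₂ => by
        have := FactorsThroughProjInj.add h₁ h₂
        rwa [sub_add_sub_cancel] at this }
  comp_left := by
    rintro X Y Z f g g' ⟨P, a, b, hP, hP', h⟩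
    exact ⟨P, f ≫ a, b, hP, hP', by rw [← Preadditive.comp_sub, h, Category.assoc]⟩
  comp_right := by
    rintro X Y Z f f' g ⟨P, a, b, hP, hP', h⟩
    exact ⟨P, a, b ≫ g, hP, hP', by rw [← Preadditive.sub_comp, h, Category.assoc]⟩

instance : Preadditive (HomotopyCat A N) :=
  Quotient.preadditive (stableRel A N) fun X Y f₁ f₂ g₁ g₂ h₁ h₂ => by
    have := FactorsThroughProjInj.add h₁ h₂
    rwa [sub_add_sub_comm] at this

/-- The sequence `X^{i-(N-r)} ⟶ X^i ⟶ X^{i+r}` with maps `d^{N-r}` and `d^r`. -/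
def cohomologyShortComplex (X : NComplex A N) (r : ℕ) (hr : r ≤ N) (i : ℤ) : ShortComplex A :=
  ShortComplex.mk
    (X.obj.map (homOfLE (show i - ((N - r : ℕ) : ℤ) ≤ i by omega)))
    (X.obj.map (homOfLE (show i ≤ i + (r : ℤ) by omega)))
    (by rw [← Functor.map_comp]; exact X.property _ _ (by omega))

/-- The cohomology `H^i_{(r)}(X) = ker (d^r)^i / im (d^{N-r})`. -/
def cohomology (X : NComplex A N) (r : ℕ) (hr : r ≤ N) (i : ℤ) : A :=
  (cohomologyShortComplex X r hr i).homology

/-- `X` is acyclic if `H^i_{(r)}(X) = 0` for all `i` and all `1 ≤ r ≤ N - 1`. -/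
def IsAcyclic (X : NComplex A N) : Prop :=
  ∀ (r : ℕ) (_ : 1 ≤ r) (hr : r < N) (i : ℤ), IsZero (cohomology X r hr.le i)

variable (A N) in
/-- The full subcategory `K_N(A)^∅` of acyclic objects of `K_N(A)`, as a property of objects. -/
def acyclic : ObjectProperty (HomotopyCat A N) := fun X => IsAcyclic X.as

variable (A N) in
/-- The full subcategory of h-projective objects of `K_N(A)`, as a property of objects. -/
def hProjective : ObjectProperty (HomotopyCat A N) :=
  fun X => ∀ T : HomotopyCat A N, acyclic A N T → ∀ f : X ⟶ T, f = 0

/-- `X ⟶ Y ⟶ Z` are the first two morphisms of a distinguished triangle `X ⟶ Y ⟶ Z ⟶ ΣX` of the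
triangulated category `K_N(A)`: the distinguished triangles of this stable category are the
triangles isomorphic in `K_N(A)` to one induced by a sequence in `S_⊕`. -/
def IsTriangle {X Y Z : HomotopyCat A N} (f : X ⟶ Y) (g : Y ⟶ Z) : Prop :=
  ∃ S : ShortComplex (NComplex A N), LevelwiseSplit S ∧
    ∃ (a : X ≅ (toHomotopyCat A N).obj S.X₁) (b : Y ≅ (toHomotopyCat A N).obj S.X₂)
      (c : Z ≅ (toHomotopyCat A N).obj S.X₃),
      f ≫ b.hom = a.hom ≫ (toHomotopyCat A N).map S.f ∧
      g ≫ c.hom = b.hom ≫ (toHomotopyCat A N).map S.g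

variable (A N) in
/-- The morphisms of `K_N(A)` whose cone is acyclic. -/
def acyclicCone : MorphismProperty (HomotopyCat A N) :=
  fun _ Y f => ∃ (Z : HomotopyCat A N) (g : Y ⟶ Z), IsTriangle f g ∧ acyclic A N Z

variable (A N) in
/-- The derived category `D_N(A)`: the Verdier quotient `K_N(A)/K_N(A)^∅`, that is, the localization
of `K_N(A)` at the morphisms whose cone lies in `K_N(A)^∅`. -/
abbrev DerivedCat := (acyclicCone A N).Localization

variable (A N) in
/-- The localization functor `π : K_N(A) ⥤ D_N(A)`. -/
abbrev toDerivedCat : HomotopyCat A N ⥤ DerivedCat A N := (acyclicCone A N).Q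

end NComplex

end

/-! Since `π` is a localization, it suffices that for h-projective `X` the functor `Hom(X, -)` sends
every `w` with acyclic cone to a bijection (`hProjective.bijective_comp`). One may take `w` to be
the first map of a levelwise split sequence `S`. Surjectivity holds because maps from `X` to the
cone vanish stably. For injectivity one wants no maps from `X` to the desuspended cone; no
suspension functor is built, and a syzygy of the cone takes its place. It is the kernel of a
levelwise split epimorphism from a sum of disks, which is relatively projective and acyclic, so the
syzygy of an acyclic complex is acyclic. -/

noncomputable section

namespace NComplex

/-! ### Hom-sets in a localization -/

section Localization

variable {C : Type*} [Category* C] (W : MorphismProperty C) (X : C)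

/-- `Hom(X, -)` inverts `W`, so it extends to the localization; evaluating the extension at the
identity of `X` recovers `f` from its image. -/
lemma map_Q_injective_of_bijective_comp
    (hW : ∀ ⦃Y Z : C⦄ (w : Y ⟶ Z), W w → Function.Bijective fun f : X ⟶ Y => f ≫ w) (Y : C) :
    Function.Injective fun f : X ⟶ Y => W.Q.map f := by
  have hinv : W.IsInvertedBy (coyoneda.obj (Opposite.op X)) := fun Y Z w hw => by
    rw [isIso_iff_bijective]
    exact hW w hw
  intro f g hfg
  let e := Localization.fac (coyoneda.obj (Opposite.op X)) hinv W.Q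
  have h : ∀ f : X ⟶ Y, (coyoneda.obj (Opposite.op X)).map f =
      e.inv.app X ≫ (Localization.lift _ hinv W.Q).map (W.Q.map f) ≫ e.hom.app Y := fun f => by
    rw [← Functor.comp_map, e.hom.naturality, Iso.inv_hom_id_app_assoc]
  have h' : (coyoneda.obj (Opposite.op X)).map f = (coyoneda.obj (Opposite.op X)).map g := by
    rw [h, h, show W.Q.map f = W.Q.map g from hfg]
  simpa using ConcreteCategory.congr_hom h' (𝟙 X)

/-- Morphisms of the localization are generated by images and formal inverses, so it is enough that
postcomposing with a generator preserves being the image of a morphism out of `X`. -/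
lemma map_Q_surjective_of_surjective_comp
    (hW : ∀ ⦃Y Z : C⦄ (w : Y ⟶ Z), W w → Function.Surjective fun f : X ⟶ Y => f ≫ w) (Y : C) :
    Function.Surjective fun f : X ⟶ Y => W.Q.map f := by
  let good : ∀ Z : W.Localization, (W.Q.obj X ⟶ Z) → Prop := fun Z g =>
    ∀ (Y : C) (h : Z = W.Q.obj Y), ∃ f : X ⟶ Y, W.Q.map f = g ≫ eqToHom h
  let P : MorphismProperty W.Localization := fun Z Z' φ => ∀ g, good Z g → good Z' (g ≫ φ)
  have : P.IsStableUnderComposition := ⟨fun φ ψ hφ hψ g hg => by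
    rw [← Category.assoc]; exact hψ _ (hφ _ hg)⟩
  have hinj : ∀ {Y Y' : C}, W.Q.obj Y = W.Q.obj Y' → Y = Y' := fun h =>
    (Localization.Construction.objEquiv W).injective h
  have hP : P = ⊤ := by
    refine Localization.Construction.morphismProperty_eq_top P ?_ ?_
    · intro Y Z f g hg Z' h
      obtain rfl := hinj h
      obtain ⟨g', hg'⟩ := hg Y rfl
      exact ⟨g' ≫ f, by simpa using congr($hg' ≫ W.Q.map f)⟩
    · intro Y Z w hw g hg Y' h
      obtain rfl := hinj h
      obtain ⟨g', hg'⟩ := hg Z rfl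
      -- The formal inverse of `w` is absorbed by dividing the representative by `w`.
      obtain ⟨f, rfl⟩ := hW w hw g'
      refine ⟨f, ?_⟩
      have hg'' : g = W.Q.map f ≫ W.Q.map w := by simpa using hg'.symm
      have : W.Q.map w ≫ Localization.Construction.wInv w hw = 𝟙 _ :=
        (Localization.Construction.wIso w hw).hom_inv_id
      simp [hg'', this]
  intro φ
  have hφ : P φ := by rw [hP]; trivial
  have hid : good _ (𝟙 (W.Q.obj X)) := fun Y h => by
    obtain rfl := hinj h
    exact ⟨𝟙 _, by simp⟩
  obtain ⟨f, hf⟩ := hφ _ hid Y rfl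
  exact ⟨f, by simpa using hf⟩

end Localization

/-! ### Sums of disks -/

section DiskSum

attribute [local instance] Abelian.hasFiniteBiproducts

variable {A : Type u} [Category.{v} A] [Abelian A] (B : ℤ → A) (N : ℕ)

/-- The biproduct of the `B j` for `n - N < j ≤ n`. -/
abbrev diskSumX (n : ℤ) : A := ⨁ fun j : Finset.Ioc (n - N) n => B j

namespace diskSum

/-- The projection to `B j`, which is zero unless `n - N < j ≤ n`. -/
def proj (n j : ℤ) : diskSumX B N n ⟶ B j :=
  if h : j ∈ Finset.Ioc (n - N) n then
    biproduct.π (fun j : Finset.Ioc (n - N) n => B j) ⟨j, h⟩ else 0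

/-- The inclusion of `B j`, which is zero unless `n - N < j ≤ n`. -/
def incl (n j : ℤ) : B j ⟶ diskSumX B N n :=
  if h : j ∈ Finset.Ioc (n - N) n then
    biproduct.ι (fun j : Finset.Ioc (n - N) n => B j) ⟨j, h⟩ else 0

variable {B N}

lemma proj_eq_zero {n j : ℤ} (h : ¬ (n - N < j ∧ j ≤ n)) : proj B N n j = 0 :=
  dif_neg (by simpa using h)

lemma incl_eq_zero {n j : ℤ} (h : ¬ (n - N < j ∧ j ≤ n)) : incl B N n j = 0 :=
  dif_neg (by simpa using h)

lemma incl_proj_self {n j : ℤ} (h : n - N < j ∧ j ≤ n) : incl B N n j ≫ proj B N n j = 𝟙 _ := by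
  have h' : j ∈ Finset.Ioc (n - N) n := by simpa using h
  simp only [incl, proj, dif_pos h']
  exact biproduct.ι_π_self _ _

lemma incl_proj_ne {n j j' : ℤ} (h : j ≠ j') : incl B N n j ≫ proj B N n j' = 0 := by
  unfold incl proj
  split_ifs
  · exact biproduct.ι_π_ne _ (by simpa using h)
  all_goals simp

lemma hom_ext {T : A} {n : ℤ} {f g : T ⟶ diskSumX B N n}
    (h : ∀ j, n - N < j → j ≤ n → f ≫ proj B N n j = g ≫ proj B N n j) : f = g := by
  refine biproduct.hom_ext _ _ fun ⟨j, hj⟩ => ?_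
  have hj' := Finset.mem_Ioc.1 hj
  simpa only [proj, dif_pos hj] using h j hj'.1 hj'.2

lemma hom_ext' {T : A} {n : ℤ} {f g : diskSumX B N n ⟶ T}
    (h : ∀ j, n - N < j → j ≤ n → incl B N n j ≫ f = incl B N n j ≫ g) : f = g := by
  refine biproduct.hom_ext' _ _ fun ⟨j, hj⟩ => ?_
  have hj' := Finset.mem_Ioc.1 hj
  simpa only [incl, dif_pos hj] using h j hj'.1 hj'.2

lemma exists_desc {T : A} (n : ℤ) (f : ∀ j : ℤ, j ≤ n → (B j ⟶ T)) :
    ∃ g : diskSumX B N n ⟶ T, ∀ j, n - N < j → ∀ h : j ≤ n, incl B N n j ≫ g = f j h := by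
  refine ⟨biproduct.desc fun j => f j (Finset.mem_Ioc.1 j.2).2, fun j h₁ h₂ => ?_⟩
  rw [incl, dif_pos (Finset.mem_Ioc.2 ⟨h₁, h₂⟩)]
  exact biproduct.ι_desc _ _

variable (B N) in
/-- The morphism which is the identity on the common summands and zero on the others. -/
def transfer (n m : ℤ) : diskSumX B N n ⟶ diskSumX B N m :=
  biproduct.lift fun j => proj B N n j

lemma transfer_proj {n m j : ℤ} (h₁ : m - N < j) (h₂ : j ≤ m) :
    transfer B N n m ≫ proj B N m j = proj B N n j := by
  rw [transfer, proj, dif_pos (Finset.mem_Ioc.2 ⟨h₁, h₂⟩)]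
  exact biproduct.lift_π _ _

lemma incl_transfer {n m j : ℤ} (h₁ : n - N < j) (h₂ : j ≤ n) :
    incl B N n j ≫ transfer B N n m = incl B N m j := by
  refine hom_ext fun k hk hk' => ?_
  rw [Category.assoc, transfer_proj hk hk']
  by_cases h : j = k
  · subst h
    rw [incl_proj_self ⟨h₁, h₂⟩, incl_proj_self ⟨hk, hk'⟩]
  · rw [incl_proj_ne h, incl_proj_ne h]

lemma transfer_transfer {n m k : ℤ} (h : n ≤ m) (h' : m ≤ k) :
    transfer B N n m ≫ transfer B N m k = transfer B N n k := by
  refine hom_ext fun j hj hj' => ?_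
  rw [Category.assoc, transfer_proj hj hj', transfer_proj hj hj']
  by_cases hm : j ≤ m
  · rw [transfer_proj (by omega) hm]
  · rw [proj_eq_zero (by omega), proj_eq_zero (by omega), comp_zero]

lemma transfer_self (n : ℤ) : transfer B N n n = 𝟙 _ :=
  hom_ext fun j hj hj' => by rw [transfer_proj hj hj', Category.id_comp]

lemma transfer_eq_zero {n m : ℤ} (h : n + N ≤ m) : transfer B N n m = 0 :=
  hom_ext fun j hj hj' => by rw [transfer_proj hj hj', proj_eq_zero (by omega), zero_comp]

/-- The summands of degree `n` surviving to degree `m` are those with `j > m - N = l`. A map killed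
there has only components `j ≤ l`, which already exist in degree `l`. -/
lemma comp_transfer_comp_transfer {T : A} {n m l : ℤ} (hl : l + N = m) (hnm : n ≤ m) (hln : l ≤ n)
    (f : T ⟶ diskSumX B N n) (hf : f ≫ transfer B N n m = 0) :
    (f ≫ transfer B N n l) ≫ transfer B N l n = f := by
  refine hom_ext fun j hj hj' => ?_
  rw [Category.assoc, transfer_proj hj hj', Category.assoc]
  by_cases h : j ≤ l
  · rw [transfer_proj (by omega) h]
  · rw [proj_eq_zero (by omega), comp_zero, comp_zero,
      ← transfer_proj (by omega : m - N < j) (by omega), reassoc_of% hf, zero_comp]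

end diskSum

/-- The `N`-complex `⨁_j (B j = ⋯ = B j)`, with `B j` in degrees `j, …, j + N - 1`. -/
def diskSum : NComplex A N where
  obj :=
    { obj := diskSumX B N
      map := fun {n m} _ => diskSum.transfer B N n m
      map_id := fun n => diskSum.transfer_self n
      map_comp := fun f g => (diskSum.transfer_transfer (leOfHom f) (leOfHom g)).symm }
  property := fun _ _ h => diskSum.transfer_eq_zero h.le

variable {B N}

lemma map_eq_zero (X : NComplex A N) {i j : ℤ} (f : i ⟶ j) (h : i + N ≤ j) :
    X.obj.map f = 0 := by
  have : f = homOfLE (show i ≤ i + N by omega) ≫ homOfLE h := Subsingleton.elim _ _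
  rw [this, Functor.map_comp, X.property i _ rfl, zero_comp]

namespace diskSum

variable (B N) in
/-- The inclusion of the generator `B j` in degree `j`. -/
def gen (j : ℤ) : B j ⟶ (diskSum B N).obj.obj j := incl B N j j

/-- With `hom_ext_of_gen`, this says that the sum of disks is free on its generators. -/
lemma exists_desc_hom (X : NComplex A N) (f : ∀ j, B j ⟶ X.obj.obj j) :
    ∃ g : diskSum B N ⟶ X, ∀ j, gen B N j ≫ g.hom.app j = f j := by
  choose g hg using fun n =>
    exists_desc (B := B) (N := N) n fun j h => f j ≫ X.obj.map (homOfLE h)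
  refine ⟨ObjectProperty.homMk { app := g, naturality := fun n m φ => ?_ },
    fun j => ?_⟩
  on_goal 2 =>
    change incl B N j j ≫ g j = f j
    -- This fails only for `N = 0`, where every complex is zero.
    by_cases hN : j - N < j
    · rw [hg j j hN le_rfl, show homOfLE (le_refl j) = 𝟙 j from rfl,
        CategoryTheory.Functor.map_id, Category.comp_id]
    · have h : 𝟙 (X.obj.obj j) = 0 := by
        rw [← CategoryTheory.Functor.map_id]
        exact map_eq_zero X _ (by omega)
      rw [← Category.comp_id (_ ≫ _), ← Category.comp_id (f j), h, comp_zero, comp_zero]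
  have hnm := leOfHom φ
  refine hom_ext' fun j hj hj' => ?_
  change incl B N n j ≫ transfer B N n m ≫ g m = incl B N n j ≫ g n ≫ X.obj.map φ
  rw [← Category.assoc, incl_transfer hj hj', ← Category.assoc, hg n j hj hj', Category.assoc,
    ← Functor.map_comp]
  by_cases h : m - N < j
  · rw [hg m j h (by omega)]
    rfl
  · rw [incl_eq_zero (by omega), map_eq_zero X _ (by omega), zero_comp, comp_zero]

lemma hom_ext_of_gen {X : NComplex A N} {f g : diskSum B N ⟶ X}
    (h : ∀ j, gen B N j ≫ f.hom.app j = gen B N j ≫ g.hom.app j) : f = g := by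
  have key : ∀ (f : diskSum B N ⟶ X) (n j : ℤ), n - N < j → ∀ hj : j ≤ n,
      incl B N n j ≫ f.hom.app n =
        (gen B N j ≫ f.hom.app j) ≫ X.obj.map (homOfLE hj) := fun f n j hj hj' => by
    let φ : ∀ i, diskSumX B N i ⟶ X.obj.obj i := fun i => f.hom.app i
    have h : transfer B N j n ≫ φ n = φ j ≫ X.obj.map (homOfLE hj') := f.hom.naturality _
    change incl B N n j ≫ φ n = (incl B N j j ≫ φ j) ≫ X.obj.map (homOfLE hj')
    rw [Category.assoc, ← h, ← Category.assoc, incl_transfer (by omega) le_rfl]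
  ext n
  refine hom_ext' fun j hj hj' => ?_
  rw [key f n j hj hj', key g n j hj hj', h]

end diskSum

end DiskSum

/-! ### Levelwise split sequences and relative projectivity -/

section LevelwiseSplit

variable {A : Type u} [Category.{v} A] [Abelian A] {N : ℕ} {S : ShortComplex (NComplex A N)}

lemma LevelwiseSplit.exists_splitting (hS : LevelwiseSplit S) (i : ℤ) :
    ∃ (r : S.X₂.obj.obj i ⟶ S.X₁.obj.obj i) (s : S.X₃.obj.obj i ⟶ S.X₂.obj.obj i),
      S.f.hom.app i ≫ r = 𝟙 _ ∧ s ≫ S.g.hom.app i = 𝟙 _ ∧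
        r ≫ S.f.hom.app i + S.g.hom.app i ≫ s = 𝟙 _ :=
  let ⟨σ⟩ := hS i
  ⟨σ.r, σ.s, σ.f_r, σ.s_g, σ.id⟩

lemma LevelwiseSplit.mono_app (hS : LevelwiseSplit S) (i : ℤ) : Mono (S.f.hom.app i) :=
  let ⟨r, _, hr, _, _⟩ := hS.exists_splitting i
  (SplitMono.mk r hr).mono

lemma LevelwiseSplit.app_comp_app (S : ShortComplex (NComplex A N)) (i : ℤ) :
    S.f.hom.app i ≫ S.g.hom.app i = 0 :=
  congr(($S.zero).hom.app i)

lemma isRelProjective_diskSum (B : ℤ → A) : IsRelProjective (diskSum B N) := by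
  intro S hS f
  choose _ s _ hs _ using hS.exists_splitting
  obtain ⟨g, hg⟩ := diskSum.exists_desc_hom S.X₂
    fun j => diskSum.gen B N j ≫ f.hom.app j ≫ s j
  refine ⟨g, diskSum.hom_ext_of_gen fun j => ?_⟩
  rw [ObjectProperty.FullSubcategory.comp_hom, NatTrans.comp_app, reassoc_of% hg j, hs,
    Category.comp_id]

end LevelwiseSplit

/-! ### Acyclicity and syzygies -/

section Acyclic

variable {A : Type u} [Category.{v} A] [Abelian A] {N : ℕ}

lemma isAcyclic_iff_exact_up_to_refinements (X : NComplex A N) :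
    IsAcyclic X ↔ ∀ (l n m : ℤ) (h₁ : l < n) (h₂ : n < m), l + N = m →
      ∀ (T : A) (x : T ⟶ X.obj.obj n), x ≫ X.obj.map (homOfLE h₂.le) = 0 →
        ∃ (T' : A) (p : T' ⟶ T) (_ : Epi p) (y : T' ⟶ X.obj.obj l),
          p ≫ x = y ≫ X.obj.map (homOfLE h₁.le) := by
  constructor
  · intro hX l n m h₁ h₂ h T x hx
    obtain ⟨r, rfl⟩ : ∃ r : ℕ, m = n + r := ⟨(m - n).toNat, by omega⟩
    obtain rfl : l = n - ((N - r : ℕ) : ℤ) := by omega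
    have hr : r < N := by omega
    have := (ShortComplex.exact_iff_isZero_homology _).2 (hX r (by omega) hr n)
    rw [ShortComplex.exact_iff_exact_up_to_refinements] at this
    exact this x hx
  · intro h r h₁ h₂ i
    refine (ShortComplex.exact_iff_isZero_homology _).1 ?_
    rw [ShortComplex.exact_iff_exact_up_to_refinements]
    intro T x hx
    exact h _ i _ (by omega) (by omega) (by omega) T x hx

/-- The kernel of a morphism of `N`-complexes. -/
def kernelComplex {X Y : NComplex A N} (f : X ⟶ Y) : NComplex A N where
  obj := kernel f.hom
  property := fun i j h => by
    rw [← cancel_mono ((kernel.ι f.hom).app j), NatTrans.naturality, X.property i j h,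
      zero_comp, comp_zero]

/-- The inclusion of the kernel of a morphism of `N`-complexes. -/
def kernelComplexι {X Y : NComplex A N} (f : X ⟶ Y) : kernelComplex f ⟶ X :=
  ObjectProperty.homMk (kernel.ι f.hom)

lemma kernelComplexι_comp {X Y : NComplex A N} (f : X ⟶ Y) : kernelComplexι f ≫ f = 0 := by
  ext1
  exact kernel.condition f.hom

lemma levelwiseSplit_kernelComplex {X Y : NComplex A N} (f : X ⟶ Y)
    (hf : ∀ i, ∃ s : Y.obj.obj i ⟶ X.obj.obj i, s ≫ f.hom.app i = 𝟙 _) :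
    LevelwiseSplit (ShortComplex.mk (kernelComplexι f) f (kernelComplexι_comp f)) := by
  intro i
  obtain ⟨s, hs⟩ := hf i
  have hex : (ShortComplex.mk (kernel.ι f.hom) f.hom (kernel.condition _)).Exact :=
    ShortComplex.exact_of_f_is_kernel _ (kernelIsKernel f.hom)
  exact ⟨.ofExactOfSection _ (hex.map ((evaluation ℤ A).obj i)) s hs
    (inferInstanceAs (Mono ((kernel.ι f.hom).app i)))⟩

/-- The kernel term of a levelwise split sequence is acyclic if the two other terms are. -/
lemma LevelwiseSplit.isAcyclic {S : ShortComplex (NComplex A N)} (hS : LevelwiseSplit S)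
    (h₂ : IsAcyclic S.X₂) (h₃ : IsAcyclic S.X₃) : IsAcyclic S.X₁ := by
  rw [isAcyclic_iff_exact_up_to_refinements] at h₂ h₃ ⊢
  intro l n m hln hnm h T x hx
  choose r s hr hs hid using hS.exists_splitting
  have hfg := LevelwiseSplit.app_comp_app S
  obtain ⟨T₁, p₁, _, y₁, hy₁⟩ := h₂ l n m hln hnm h T (x ≫ S.f.hom.app n) (by
    rw [Category.assoc, ← S.f.hom.naturality, reassoc_of% hx, zero_comp])
  obtain ⟨T₂, p₂, _, y₂, hy₂⟩ := h₃ (n - N) l n (by omega) hln (by omega) T₁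
    (y₁ ≫ S.g.hom.app l) (by
      rw [Category.assoc, ← S.g.hom.naturality, ← reassoc_of% hy₁, hfg, comp_zero, comp_zero])
  -- Correcting `y₁` by a boundary from degree `n - N` moves it into the kernel of `S.g`; its image
  -- in degree `n` is unchanged because `d^N = 0`.
  let z : T₂ ⟶ S.X₂.obj.obj l :=
    p₂ ≫ y₁ - y₂ ≫ s (n - N) ≫ S.X₂.obj.map (homOfLE (by omega))
  have hz : z ≫ S.g.hom.app l = 0 := by
    simp only [z, Preadditive.sub_comp, Category.assoc, S.g.hom.naturality]
    rw [reassoc_of% hs, hy₂, sub_self]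
  have hz' : (z ≫ r l) ≫ S.f.hom.app l = z := by
    have := z ≫= hid l
    rwa [Preadditive.comp_add, reassoc_of% hz, zero_comp, add_zero, Category.comp_id,
      ← Category.assoc] at this
  have := hS.mono_app n
  refine ⟨T₂, p₂ ≫ p₁, inferInstance, z ≫ r l, ?_⟩
  rw [← cancel_mono (S.f.hom.app n), Category.assoc, Category.assoc, hy₁, Category.assoc,
    S.f.hom.naturality, ← Category.assoc (z ≫ _), hz']
  simp only [z, Preadditive.sub_comp, Category.assoc, ← Functor.map_comp]
  rw [map_eq_zero S.X₂ (i := n - N) (j := n) _ (by omega), comp_zero, comp_zero, sub_zero]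

lemma isAcyclic_diskSum (B : ℤ → A) : IsAcyclic (diskSum B N) := by
  rw [isAcyclic_iff_exact_up_to_refinements]
  intro l n m hln hnm h T x hx
  exact ⟨T, 𝟙 T, inferInstance, x ≫ diskSum.transfer B N n l, by
    rw [Category.id_comp]
    exact (diskSum.comp_transfer_comp_transfer h hnm.le hln.le x hx).symm⟩

/-- Enough relative projectives, with control on the acyclicity of the syzygy. -/
lemma exists_projective_presentation (X : NComplex A N) :
    ∃ (K Q : NComplex A N) (k : K ⟶ Q) (q : Q ⟶ X) (w : k ≫ q = 0),
      LevelwiseSplit (ShortComplex.mk k q w) ∧ IsRelProjective Q ∧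
        (IsAcyclic X → IsAcyclic K) := by
  -- With one disk per `X^j`, the generators themselves split `q` in each degree.
  obtain ⟨q, hq⟩ := diskSum.exists_desc_hom (B := X.obj.obj) X fun j => 𝟙 _
  have hS := levelwiseSplit_kernelComplex q fun i => ⟨diskSum.gen _ N i, hq i⟩
  exact ⟨_, _, _, q, _, hS, isRelProjective_diskSum _, hS.isAcyclic (isAcyclic_diskSum _)⟩

end Acyclic

/-! ### Lifting modulo projective-injectives -/

section Stable

variable {A : Type u} [Category.{v} A] [Abelian A] {N : ℕ}

/-- The retractions need not commute with `d`, but the lifts they give do, since `S.f` is a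
levelwise monomorphism. -/
lemma LevelwiseSplit.exists_lift {S : ShortComplex (NComplex A N)} (hS : LevelwiseSplit S)
    {T : NComplex A N} (h : T ⟶ S.X₂) (hh : h ≫ S.g = 0) : ∃ e : T ⟶ S.X₁, e ≫ S.f = h := by
  choose r _ _ _ hid using hS.exists_splitting
  have hhi : ∀ i, h.hom.app i ≫ S.g.hom.app i = 0 := fun i => congr(($hh).hom.app i)
  have hfac : ∀ i, (h.hom.app i ≫ r i) ≫ S.f.hom.app i = h.hom.app i := fun i => by
    have := h.hom.app i ≫= hid i
    rwa [Preadditive.comp_add, reassoc_of% (hhi i), zero_comp, add_zero, Category.comp_id,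
      ← Category.assoc] at this
  refine ⟨ObjectProperty.homMk
    { app := fun i => h.hom.app i ≫ r i, naturality := fun i j φ => ?_ }, ?_⟩
  · have := hS.mono_app j
    rw [← cancel_mono (S.f.hom.app j), Category.assoc, hfac, Category.assoc, S.f.hom.naturality,
      ← Category.assoc, hfac, h.hom.naturality]
  · ext i
    exact hfac i

lemma LevelwiseSplit.mono_f {S : ShortComplex (NComplex A N)} (hS : LevelwiseSplit S) :
    Mono S.f := by
  refine ⟨fun a b h => ?_⟩
  ext i
  have := hS.mono_app i
  rw [← cancel_mono (S.f.hom.app i)]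
  exact congr(($h).hom.app i)

lemma toHomotopyCat_map_eq_iff {X Y : NComplex A N} (f g : X ⟶ Y) :
    (toHomotopyCat A N).map f = (toHomotopyCat A N).map g ↔ FactorsThroughProjInj (f - g) :=
  Quotient.functor_map_eq_iff _ _ _

lemma toHomotopyCat_map_eq_zero_iff {X Y : NComplex A N} (f : X ⟶ Y) :
    (toHomotopyCat A N).map f = 0 ↔ FactorsThroughProjInj f := by
  have : (toHomotopyCat A N).map (0 : X ⟶ Y) = 0 := rfl
  rw [← this, toHomotopyCat_map_eq_iff, sub_zero]

lemma FactorsThroughProjInj.comp_right {X Y Z : NComplex A N} {f : X ⟶ Y}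
    (hf : FactorsThroughProjInj f) (g : Y ⟶ Z) : FactorsThroughProjInj (f ≫ g) := by
  obtain ⟨P, a, b, hP, hP', rfl⟩ := hf
  exact ⟨P, a, b ≫ g, hP, hP', Category.assoc _ _ _⟩

variable {X : NComplex A N} (hX : hProjective A N ((toHomotopyCat A N).obj X))
  {S : ShortComplex (NComplex A N)} (hS : LevelwiseSplit S)
  {Z : HomotopyCat A N} (hZ : acyclic A N Z) (c : Z ≅ (toHomotopyCat A N).obj S.X₃)

include hX in
lemma hProjective.factorsThroughProjInj {T : NComplex A N} (hT : IsAcyclic T) (f : X ⟶ T) :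
    FactorsThroughProjInj f :=
  (toHomotopyCat_map_eq_zero_iff f).1 (hX ((toHomotopyCat A N).obj T) hT _)

include hX hS hZ c in
lemma LevelwiseSplit.exists_comp_sub_factors (f : X ⟶ S.X₂) :
    ∃ g : X ⟶ S.X₁, FactorsThroughProjInj (g ≫ S.f - f) := by
  have h₀ : (toHomotopyCat A N).map (f ≫ S.g) = 0 := by
    have := hX Z hZ ((toHomotopyCat A N).map (f ≫ S.g) ≫ c.inv)
    rwa [Iso.comp_inv_eq, zero_comp] at this
  obtain ⟨P, a, b, hP, hP', h⟩ := (toHomotopyCat_map_eq_zero_iff _).1 h₀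
  -- Lifting `b` allows `f` to be changed within its stable class so that it is strictly killed by
  -- `S.g`.
  obtain ⟨b', rfl⟩ := hP S hS b
  obtain ⟨e, he⟩ := hS.exists_lift (f - a ≫ b') (by simp [h])
  exact ⟨e, P, a, -b', hP, hP', by simp [he]⟩

include hX hS hZ c in
-- The map `φ` is `a ≫ e'`, through `P`, plus `κ ≫ e`, through the syzygy `K` of the acyclic complex
-- `Z.as`; h-projectivity disposes of `κ`.
lemma LevelwiseSplit.factors_of_comp_factors (φ : X ⟶ S.X₁)
    (hφ : FactorsThroughProjInj (φ ≫ S.f)) : FactorsThroughProjInj φ := by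
  obtain ⟨P, a, b, hP, hP', hab⟩ := hφ
  -- Acyclicity is given for `Z.as`, not for `S.X₃`, so the two are compared by representatives `γ`,
  -- `γ'` of the stable isomorphism; the error `u ≫ v` is lifted separately.
  obtain ⟨γ, hγ⟩ := (toHomotopyCat A N).map_surjective (X := S.X₃) (Y := Z.as) c.inv
  obtain ⟨γ', hγ'⟩ := (toHomotopyCat A N).map_surjective (X := Z.as) (Y := S.X₃) c.hom
  obtain ⟨R, u, v, hR, -, huv⟩ : FactorsThroughProjInj (𝟙 S.X₃ - γ ≫ γ') := by
    rw [← toHomotopyCat_map_eq_iff, Functor.map_comp, hγ, hγ', CategoryTheory.Functor.map_id]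
    exact c.inv_hom_id.symm
  obtain ⟨K, Q, k, q, w, hKQ, hQ, hK⟩ := exists_projective_presentation Z.as
  obtain ⟨h, hh⟩ := hP _ hKQ (b ≫ S.g ≫ γ)
  obtain ⟨q', hq'⟩ := hQ S hS (q ≫ γ')
  obtain ⟨v', hv'⟩ := hR S hS v
  have habg : a ≫ b ≫ S.g = 0 := by
    rw [← Category.assoc, ← hab, Category.assoc, S.zero, comp_zero]
  dsimp at h hh
  obtain ⟨κ, hκ⟩ := hKQ.exists_lift (a ≫ h) (by simp [hh, reassoc_of% habg])
  obtain ⟨e, he⟩ := hS.exists_lift (k ≫ q') (by simp [hq', reassoc_of% w])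
  -- After `S.g` the subtracted terms become `b ≫ S.g ≫ γ ≫ γ'` and `b ≫ S.g ≫ (𝟙 - γ ≫ γ')`, which
  -- add up to `b ≫ S.g`.
  obtain ⟨e', he'⟩ := hS.exists_lift (b - h ≫ q' - b ≫ S.g ≫ u ≫ v') (by
    simp only [Preadditive.sub_comp, Category.assoc, hq', hv', ← huv, reassoc_of% hh]
    simp)
  dsimp at κ hκ
  have := hS.mono_f
  have key : φ = a ≫ e' + κ ≫ e := by
    rw [← cancel_mono S.f, Preadditive.add_comp, Category.assoc, Category.assoc, he, he',
      reassoc_of% hκ, hab]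
    simp [reassoc_of% habg]
  rw [key]
  exact .add ⟨P, a, e', hP, hP', rfl⟩
    ((hProjective.factorsThroughProjInj hX (hK hZ) κ).comp_right e)

end Stable

lemma hProjective.bijective_comp {A : Type u} [Category.{v} A] [Abelian A] {N : ℕ}
    {X : HomotopyCat A N} (hX : hProjective A N X) ⦃Y Z : HomotopyCat A N⦄ (w : Y ⟶ Z)
    (hw : acyclicCone A N w) : Function.Bijective fun f : X ⟶ Y => f ≫ w := by
  obtain ⟨C, g, ⟨S, hS, a, b, c, hab, -⟩, hC⟩ := hw
  have hw : w = a.hom ≫ (toHomotopyCat A N).map S.f ≫ b.inv := by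
    rw [← Category.assoc, ← hab, Category.assoc, b.hom_inv_id, Category.comp_id]
  constructor
  · refine (injective_iff_map_eq_zero (Preadditive.rightComp X w)).2 ?_
    intro f hf
    change f ≫ w = 0 at hf
    obtain ⟨φ, hφ⟩ := (toHomotopyCat A N).map_surjective (X := X.as) (Y := S.X₁) (f ≫ a.hom)
    have h₀ : (toHomotopyCat A N).map φ = 0 := by
      rw [toHomotopyCat_map_eq_zero_iff]
      refine hS.factors_of_comp_factors hX hC c φ ?_
      rw [← toHomotopyCat_map_eq_zero_iff, Functor.map_comp, hφ, ← cancel_mono b.inv]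
      simpa [hw] using hf
    rw [← cancel_mono a.hom, ← hφ, h₀, zero_comp]
  · intro f
    obtain ⟨φ, hφ⟩ := (toHomotopyCat A N).map_surjective (X := X.as) (Y := S.X₂) (f ≫ b.hom)
    obtain ⟨ψ, hψ⟩ := hS.exists_comp_sub_factors hX hC c φ
    rw [← toHomotopyCat_map_eq_iff, Functor.map_comp, hφ] at hψ
    refine ⟨(toHomotopyCat A N).map ψ ≫ a.inv, ?_⟩
    dsimp only
    rw [hw, Category.assoc, Iso.inv_hom_id_assoc, reassoc_of% hψ, b.hom_inv_id]
    exact Category.comp_id f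

end NComplex

end

theorem mainTheorem7 {A : Type u} [Category.{v} A] [Abelian A] (N : ℕ) :
    (∀ X : NComplex.HomotopyCat A N, NComplex.hProjective A N X →
      ∀ Y : NComplex.HomotopyCat A N,
        Function.Bijective
          (fun f : X ⟶ Y => (NComplex.toDerivedCat A N).map f)) ∧
    ((NComplex.hProjective A N).ι ⋙ NComplex.toDerivedCat A N).Full ∧
    ((NComplex.hProjective A N).ι ⋙ NComplex.toDerivedCat A N).Faithful := by
  have key : ∀ X : NComplex.HomotopyCat A N, NComplex.hProjective A N X →
      ∀ Y : NComplex.HomotopyCat A N,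
        Function.Bijective (fun f : X ⟶ Y => (NComplex.toDerivedCat A N).map f) :=
    fun X hX Y =>
      ⟨NComplex.map_Q_injective_of_bijective_comp _ X hX.bijective_comp Y,
        NComplex.map_Q_surjective_of_surjective_comp _ X
          (fun _ _ w hw => (hX.bijective_comp w hw).2) Y⟩
  refine ⟨key, ⟨fun {X Y} f => ?_⟩, ⟨fun {X Y} f g h => ?_⟩⟩
  · obtain ⟨g, hg⟩ := (key X.obj X.property Y.obj).2 f
    exact ⟨ObjectProperty.homMk g, hg⟩
  · exact ObjectProperty.hom_ext _ ((key X.obj X.property Y.obj).1 h)
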